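/- \textbf{Setting.} Let $E,J,R\in\mathbb C^{n\times n}$ and $B\in\mathbb C^{n\times m}$ with $E=E^H\ge 0$, $J=-J^H$, $R=R^H\ge 0$; these are the coefficients of the port-Hamiltonian descriptor system $E\dot x=(J-R)x+Bu$, $y=B^Hx$. Here $M\ge 0$ means that $M$ is Hermitian positive semidefinite. For a matrix $M$, let $\mathcal S_\infty(M)$ (resp. $\mathcal T_\infty(M)$) denote any matrix of full column rank whose columns span the right nullspace $\{x: Mx=0\}$ (resp. the left nullspace $\{x: x^HM=0\}$) of $M$. A square pencil $\lambda \mathcal E-\mathcal A$ (or pair $(\mathcal E,\mathcal A)$) is regular if $\det(\lambda_0\mathcal E-\mathcal A)\neq0$ for some $\lambda_0\in\mathbb C$; its index is the size of the largest nilpotent (infinite) Jordan block in its Kronecker form, and $0$ if $\mathcal E$ is invertible; $\lambda_0\in\mathbb C$ is a finite eigenvalue if $\operatorname{rank}(\lambda_0\mathcal E-\mathcal A)<\max_{\alpha\in\mathbb C}\operatorname{rank}(\alpha\mathcal E-\mathcal A)$. Consider the conditions $$\operatorname{rank}\,[\,E,\ J-R,\ B\,]=n,\tag{1}$$ $$\operatorname{rank}\Bigl(\mathcal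 T_\infty(B)^H\,E\;\mathcal S_\infty\bigl(\mathcal T_\infty([\,E,\ B\,])^H(J-R)\bigr)\Bigr)=\operatorname{rank}[\,E,\ B\,]-\operatorname{rank}(B),\tag{2}$$ $$\operatorname{rank}\,[\,J-R-sE,\ B\,]=n\quad\text{for all } s\in\mathbb C \text{ with } \operatorname{Re}s=0\tag{3}$$ (so $s=0$ is included in (3)). \textbf{Theorem.} There exist $K,F_S,F_H\in\mathbb C^{m\times m}$ with $F_S=-F_S^H$ and $F_H=F_H^H$ such that the pair $$\bigl(E+BKB^H,\ J+BF_SB^H-(R+BF_HB^H)\bigr)$$ is regular, of index at most one, has all its finite eigenvalues in the open left half plane, and $$E+BKB^H\ge 0,\qquad R+BF_HB^H\ge 0,$$ if and only if (1), (2) and (3) hold. Moreover, if (1), (2) and (3) hold, then for any given integer $r$ there exist $K,F_S,F_H$ with all these properties and in addition $\operatorname{rank}(E+BKB^H)=r$ if and only if $$\operatorname{rank}[\,E,\ B\,]-\operatorname{rank}(B)\ \le\ r\ \le\ \operatorname{rank}\Bigl(\mathcal T_\infty\Bigl((J-R)\,\mathcal S_\infty\Bigl(\begin{bmatrix}E\\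 B^H\end{bmatrix}\Bigr)\Bigr)^H[\,E,\ B\,]\Bigr).$$ -/

import Mathlib

open scoped Matrix ComplexOrder

/-- The columns of `S` form a basis of the right nullspace `{x | M x = 0}` of `M`; that is, `S` is a
matrix of full column rank whose columns span the right nullspace (a matrix `S_∞(M)`). -/
def IsRightNullBasis {α : Type} {b k : ℕ} (M : Matrix α (Fin b) ℂ) (S : Matrix (Fin b) (Fin k) ℂ) :
    Prop :=
  LinearIndependent ℂ S.col ∧ Submodule.span ℂ (Set.range S.col) = LinearMap.ker M.mulVecLin

/-- The columns of `T` form a basis of the left nullspace `{x | xᴴ M = 0} = {x | Mᴴ x = 0}` of `M`;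
that is, `T` has full column rank and its columns span the left nullspace (a matrix `T_∞(M)`). -/
def IsLeftNullBasis {a k : ℕ} {β : Type} (M : Matrix (Fin a) β ℂ)
    (T : Matrix (Fin a) (Fin k) ℂ) : Prop :=
  LinearIndependent ℂ T.col ∧ Submodule.span ℂ (Set.range T.col) = LinearMap.ker Mᴴ.mulVecLin

/-- The pencil `λ E - A` is regular. -/
def PencilRegular {n : ℕ} (E A : Matrix (Fin n) (Fin n) ℂ) : Prop :=
  ∃ z : ℂ, (z • E - A).det ≠ 0

/-- `z` is a finite eigenvalue of `λ E - A`: the rank of `z E - A` is smaller than the maximal rank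
of `α E - A` over all complex `α`. -/
def IsFiniteEigenvalue {n : ℕ} (E A : Matrix (Fin n) (Fin n) ℂ) (z : ℂ) : Prop :=
  ∃ α : ℂ, (z • E - A).rank < (α • E - A).rank

/-- The nilpotent Jordan block of size `σ`, with ones on the first superdiagonal. -/
def nilpotentJordanBlock (σ : ℕ) : Matrix (Fin σ) (Fin σ) ℂ :=
  Matrix.of fun i j => if (i : ℕ) + 1 = (j : ℕ) then 1 else 0

/-- `ν` is the index of the (regular) pencil `λ E - A`: there are nonsingular `S`, `T` such that
`S (λ E - A) T` is the block diagonal matrix with a finite part `λ I - Λ` and blocks `λ N_j - I`,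
where the `N_j` are the nilpotent Jordan blocks of sizes `σ_j ≥ 1`, and `ν` is the size of the
largest of these blocks (`ν = 0` if there are none, i.e. if `E` is invertible).
The finite part `Λ` plays no role for the index, so it is not brought to Jordan form here. -/
def IsPencilIndex {n : ℕ} (E A : Matrix (Fin n) (Fin n) ℂ) (ν : ℕ) : Prop :=
  ∃ (p q : ℕ) (σ : Fin q → ℕ) (e : (Fin p ⊕ (Σ j : Fin q, Fin (σ j))) ≃ Fin n)
    (S T : Matrix (Fin n) (Fin n) ℂ) (Λ : Matrix (Fin p) (Fin p) ℂ),
    IsUnit S ∧ IsUnit T ∧ (∀ j, 1 ≤ σ j) ∧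
    S * E * T = Matrix.reindex e e
      (Matrix.fromBlocks 1 0 0 (Matrix.blockDiagonal' fun j => nilpotentJordanBlock (σ j))) ∧
    S * A * T = Matrix.reindex e e (Matrix.fromBlocks Λ 0 0 1) ∧
    ν = Finset.univ.sup σ

/-- The feedback matrices `K`, `F_S = -F_Sᴴ`, `F_H = F_Hᴴ` make the closed loop pair
`(E + B K Bᴴ, J + B F_S Bᴴ - (R + B F_H Bᴴ))` regular, of index at most one, with all finite
eigenvalues in the open left half plane, and `E + B K Bᴴ ≥ 0`, `R + B F_H Bᴴ ≥ 0`. -/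
def IsStabilizingFeedback {n m : ℕ} (E J R : Matrix (Fin n) (Fin n) ℂ)
    (B : Matrix (Fin n) (Fin m) ℂ) (K F_S F_H : Matrix (Fin m) (Fin m) ℂ) : Prop :=
  F_S = -F_Sᴴ ∧ F_H = F_Hᴴ ∧
  PencilRegular (E + B * K * Bᴴ) (J + B * F_S * Bᴴ - (R + B * F_H * Bᴴ)) ∧
  (∃ ν : ℕ, IsPencilIndex (E + B * K * Bᴴ) (J + B * F_S * Bᴴ - (R + B * F_H * Bᴴ)) ν ∧ ν ≤ 1) ∧
  (∀ z : ℂ, IsFiniteEigenvalue (E + B * K * Bᴴ) (J + B * F_S * Bᴴ - (R + B * F_H * Bᴴ)) z →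
    z.re < 0) ∧
  (E + B * K * Bᴴ).PosSemidef ∧ (R + B * F_H * Bᴴ).PosSemidef

/-! ### Ranges, kernels and ranks of complex matrices. -/

section LinearAlgebra

open Module

/-! Write A = J - R and N = ker E ∩ ker Bᴴ. For a regular pencil, index at most one means ker E ∩
A⁻¹(im E) = 0. Feedback does not act on ker Bᴴ, and dissipativity trades A for Aᴴ: if xᴴ A x = 0,
then R x = 0 and Aᴴ x = -A x.

Conditions (1) and (2) together say that x ∈ N, w ∈ ker Bᴴ and Aᴴ x = E w force x = 0
(`rank_conditions_iff`). This is the dual index condition of any admissible closed loop, restricted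
to vectors that feedback cannot reach. Condition (3) is likewise inherited from the closed loop. The
rank bounds hold because T₁ᴴ kills the feedback term, and because im(E + B K Bᴴ) ⊆ im [E, B] meets A
N only in 0.

Conversely, take F_S = 0 and F_H = 1. The closed-loop dissipation then has kernel ker R ∩ ker Bᴴ, so
an eigenvector in the closed right half plane would contradict (3), and index at most one follows
once im(E + B K Bᴴ) ∩ A N = 0 (`isStabilizingFeedback_of_range`). The matrix K can be chosen so that
this image is E(ker Bᴴ) ⊕ D for any subspace D of im B (`exists_feedback_range_eq`). A dimension
count gives such D, with the sum avoiding A N, in every dimension that the bounds allow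
(`exists_submodule_of_le`). -/

theorem star_dotProduct_mulVec_eq {α β : Type*} [Fintype α] [Fintype β] (M : Matrix α β ℂ)
    (x : α → ℂ) (y : β → ℂ) : star x ⬝ᵥ (M *ᵥ y) = star (Mᴴ *ᵥ x) ⬝ᵥ y := by
  rw [Matrix.star_mulVec, Matrix.conjTranspose_conjTranspose, Matrix.dotProduct_mulVec]

/-- A vector orthogonal to the left nullspace of `M` lies in the range of `M`. -/
theorem exists_mulVec_eq_of_orthogonal {α β : Type*} [Fintype α] [DecidableEq α] [Fintype β]
    (M : Matrix α β ℂ) (v : α → ℂ) (h : ∀ x, Mᴴ *ᵥ x = 0 → star x ⬝ᵥ v = 0) :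
    ∃ y, M *ᵥ y = v := by
  by_contra hv
  have hv' : v ∉ LinearMap.range M.mulVecLin := by
    rintro ⟨y, hy⟩
    exact hv ⟨y, by simpa using hy⟩
  obtain ⟨f, hf, hle⟩ := Submodule.exists_le_ker_of_notMem hv'
  -- A functional that vanishes on the range but not at v is a dot product with some w; `star w` is
  -- then a left null vector of M not orthogonal to v.
  have hfx : ∀ x, f x = (fun i => f (Pi.single i 1)) ⬝ᵥ x := by
    intro x
    conv_lhs => rw [pi_eq_sum_univ' x]
    rw [map_sum, dotProduct]
    refine Finset.sum_congr rfl fun i _ => ?_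
    rw [map_smul, smul_eq_mul, mul_comm]
  set w : α → ℂ := fun i => f (Pi.single i 1)
  apply hf
  rw [hfx, ← star_star w]
  apply h
  have h0 : ∀ y, star (Mᴴ *ᵥ star w) ⬝ᵥ y = 0 := by
    intro y
    rw [← star_dotProduct_mulVec_eq, star_star, ← hfx]
    exact hle ⟨y, rfl⟩
  exact star_eq_zero.mp (dotProduct_eq_zero _ h0)

theorem exists_mulVec_iff_orthogonal {α β : Type*} [Fintype α] [DecidableEq α] [Fintype β]
    (M : Matrix α β ℂ) (v : α → ℂ) :
    (∃ y, M *ᵥ y = v) ↔ ∀ x, Mᴴ *ᵥ x = 0 → star x ⬝ᵥ v = 0 := by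
  refine ⟨?_, exists_mulVec_eq_of_orthogonal M v⟩
  rintro ⟨y, rfl⟩ x hx
  rw [star_dotProduct_mulVec_eq, hx]
  simp

theorem IsLeftNullBasis.exists_mulVec_iff {a k : ℕ} {β : Type} {M : Matrix (Fin a) β ℂ}
    {T : Matrix (Fin a) (Fin k) ℂ} (h : IsLeftNullBasis M T) (x : Fin a → ℂ) :
    (∃ y, T *ᵥ y = x) ↔ Mᴴ *ᵥ x = 0 := by
  have h2 := h.2
  rw [← Matrix.range_mulVecLin] at h2
  have := SetLike.ext_iff.mp h2 x
  simpa using this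

theorem IsRightNullBasis.exists_mulVec_iff {α : Type} {b k : ℕ} {M : Matrix α (Fin b) ℂ}
    {S : Matrix (Fin b) (Fin k) ℂ} (h : IsRightNullBasis M S) (x : Fin b → ℂ) :
    (∃ y, S *ᵥ y = x) ↔ M *ᵥ x = 0 := by
  have h2 := h.2
  rw [← Matrix.range_mulVecLin] at h2
  have := SetLike.ext_iff.mp h2 x
  simpa using this

/-- The left nullspace of a left null basis of `M` is the range of `M`. -/
theorem IsLeftNullBasis.conjTranspose_mulVec_eq_zero_iff {a k : ℕ} {β : Type} [Fintype β]
    {M : Matrix (Fin a) β ℂ} {T : Matrix (Fin a) (Fin k) ℂ} (h : IsLeftNullBasis M T)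
    (x : Fin a → ℂ) : Tᴴ *ᵥ x = 0 ↔ ∃ y, M *ᵥ y = x := by
  rw [exists_mulVec_iff_orthogonal]
  constructor
  · intro hx w hw
    obtain ⟨y, rfl⟩ := (h.exists_mulVec_iff w).mpr hw
    rw [Matrix.star_mulVec, ← Matrix.dotProduct_mulVec, hx]
    simp
  · intro hx
    have h0 : ∀ y, star y ⬝ᵥ (Tᴴ *ᵥ x) = 0 := by
      intro y
      rw [star_dotProduct_mulVec_eq, Matrix.conjTranspose_conjTranspose]
      exact hx _ ((h.exists_mulVec_iff _).mp ⟨y, rfl⟩)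
    exact dotProduct_star_self_eq_zero.mp (h0 _)

/-- The left nullspace of a right null basis of `M` is the range of `Mᴴ`. -/
theorem IsRightNullBasis.conjTranspose_mulVec_eq_zero_iff {b k : ℕ} {α : Type} [Fintype α]
    {M : Matrix α (Fin b) ℂ} {S : Matrix (Fin b) (Fin k) ℂ} (h : IsRightNullBasis M S)
    (x : Fin b → ℂ) : Sᴴ *ᵥ x = 0 ↔ ∃ y, Mᴴ *ᵥ y = x := by
  have h' : IsLeftNullBasis Mᴴ S := by
    simpa [IsLeftNullBasis, IsRightNullBasis] using h
  exact h'.conjTranspose_mulVec_eq_zero_iff x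

theorem rank_mul_add_finrank_inf {α β γ : Type*} [Fintype α] [Fintype β] [Fintype γ]
    (C : Matrix α β ℂ) (M : Matrix β γ ℂ) :
    (C * M).rank + finrank ℂ ↥(LinearMap.range M.mulVecLin ⊓ LinearMap.ker C.mulVecLin) =
      M.rank := by
  have h := LinearMap.finrank_range_add_finrank_ker
    (C.mulVecLin.domRestrict (LinearMap.range M.mulVecLin))
  have h1 : LinearMap.range (C.mulVecLin.domRestrict (LinearMap.range M.mulVecLin)) =
      LinearMap.range (C * M).mulVecLin := by
    rw [LinearMap.range_domRestrict, Matrix.mulVecLin_mul, LinearMap.range_comp]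
  have h2 : finrank ℂ (LinearMap.ker (C.mulVecLin.domRestrict (LinearMap.range M.mulVecLin))) =
      finrank ℂ ↥(LinearMap.range M.mulVecLin ⊓ LinearMap.ker C.mulVecLin) := by
    rw [LinearMap.ker_domRestrict, ← Submodule.map_comap_subtype,
      Submodule.finrank_map_subtype_eq]
  rw [h1, h2] at h
  exact h

theorem rank_mul_eq_iff {α β γ : Type*} [Fintype α] [Fintype β] [Fintype γ]
    (C : Matrix α β ℂ) (M : Matrix β γ ℂ) :
    (C * M).rank = M.rank ↔ ∀ x, C *ᵥ (M *ᵥ x) = 0 → M *ᵥ x = 0 := by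
  have h := rank_mul_add_finrank_inf C M
  have h1 : (C * M).rank = M.rank ↔
      LinearMap.range M.mulVecLin ⊓ LinearMap.ker C.mulVecLin = ⊥ := by
    rw [← Submodule.finrank_eq_zero (R := ℂ)]
    omega
  rw [h1, Submodule.eq_bot_iff]
  constructor
  · intro H x hx
    exact H _ ⟨⟨x, rfl⟩, hx⟩
  · rintro H _ ⟨⟨x, rfl⟩, hx⟩
    exact H x hx

theorem rank_eq_iff_left_kernel {n : ℕ} {β : Type*} [Fintype β] (M : Matrix (Fin n) β ℂ) :
    M.rank = n ↔ ∀ x, Mᴴ *ᵥ x = 0 → x = 0 := by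
  have h := LinearMap.finrank_range_add_finrank_ker Mᴴ.mulVecLin
  have h1 : finrank ℂ (LinearMap.range Mᴴ.mulVecLin) = M.rank := M.rank_conjTranspose
  rw [h1, finrank_fin_fun] at h
  have h2 : M.rank = n ↔ LinearMap.ker Mᴴ.mulVecLin = ⊥ := by
    rw [← Submodule.finrank_eq_zero (R := ℂ)]
    omega
  rw [h2, Submodule.eq_bot_iff]
  rfl

theorem conjTranspose_fromCols_mulVec_eq_zero_iff {n : ℕ} {β γ : Type*}
    (M : Matrix (Fin n) β ℂ) (N : Matrix (Fin n) γ ℂ) (x : Fin n → ℂ) :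
    (Matrix.fromCols M N)ᴴ *ᵥ x = 0 ↔ Mᴴ *ᵥ x = 0 ∧ Nᴴ *ᵥ x = 0 := by
  rw [Matrix.conjTranspose_fromCols_eq_fromRows_conjTranspose, Matrix.fromRows_mulVec]
  constructor
  · intro h
    exact ⟨funext fun i => congrFun h (Sum.inl i), funext fun i => congrFun h (Sum.inr i)⟩
  · rintro ⟨h1, h2⟩
    rw [h1, h2]
    ext (i | i) <;> rfl

theorem fromRows_mulVec_eq_zero_iff {n : ℕ} {β γ : Type*}
    (M : Matrix β (Fin n) ℂ) (N : Matrix γ (Fin n) ℂ) (x : Fin n → ℂ) :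
    Matrix.fromRows M N *ᵥ x = 0 ↔ M *ᵥ x = 0 ∧ N *ᵥ x = 0 := by
  rw [Matrix.fromRows_mulVec]
  constructor
  · intro h
    exact ⟨funext fun i => congrFun h (Sum.inl i), funext fun i => congrFun h (Sum.inr i)⟩
  · rintro ⟨h1, h2⟩
    rw [h1, h2]
    ext (i | i) <;> rfl

/-- G extends to the whole space a linear right inverse of M defined on its range. -/
theorem exists_generalizedInverse {α β : Type*} [Fintype α] [DecidableEq α] [Fintype β]
    [DecidableEq β] (M : Matrix α β ℂ) : ∃ G : Matrix β α ℂ, M * G * M = M := by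
  obtain ⟨h, hh⟩ := LinearMap.exists_rightInverse_of_surjective M.mulVecLin.rangeRestrict
    (LinearMap.range_rangeRestrict _)
  obtain ⟨g, hg⟩ := LinearMap.exists_extend h
  refine ⟨LinearMap.toMatrix' g, ?_⟩
  apply Matrix.toLin'.injective
  ext1 i
  ext1
  rw [Matrix.toLin'_mul, Matrix.toLin'_mul, Matrix.toLin'_toMatrix']
  simp only [LinearMap.comp_apply]
  generalize (LinearMap.single ℂ (fun _ => ℂ) i) 1 = x
  have h1 : g (Matrix.toLin' M x) = h (M.mulVecLin.rangeRestrict x) := by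
    rw [← hg]; rfl
  rw [h1]
  exact congrArg Subtype.val (LinearMap.congr_fun hh (M.mulVecLin.rangeRestrict x))

/-- A Hermitian matrix whose columns lie in the range of `B` has the form `B X Bᴴ`. -/
theorem exists_eq_mul_mul_conjTranspose {α β : Type*} [Fintype α] [DecidableEq α] [Fintype β]
    [DecidableEq β] {M : Matrix α α ℂ} (hM : M.IsHermitian) (B : Matrix α β ℂ)
    (h : ∀ w, Bᴴ *ᵥ w = 0 → M *ᵥ w = 0) : ∃ X : Matrix β β ℂ, M = B * X * Bᴴ := by
  obtain ⟨G, hG⟩ := exists_generalizedInverse B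
  -- B G fixes the range of B, which contains the columns of M because M is Hermitian and vanishes
  -- on ker Bᴴ.
  have h1 : B * G * M = M := by
    apply Matrix.ext_of_mulVec_single
    intro i
    have : ∃ y, B *ᵥ y = M *ᵥ Pi.single i 1 := by
      apply exists_mulVec_eq_of_orthogonal
      intro w hw
      rw [star_dotProduct_mulVec_eq, hM.eq, h w hw]
      simp
    obtain ⟨y, hy⟩ := this
    rw [← Matrix.mulVec_mulVec, ← hy, Matrix.mulVec_mulVec, hG]
  refine ⟨G * M * Gᴴ, ?_⟩
  have h2 : M * (Gᴴ * Bᴴ) = M := by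
    have := congrArg Matrix.conjTranspose h1
    simpa [Matrix.conjTranspose_mul, hM.eq, Matrix.mul_assoc] using this
  calc M = B * G * M := h1.symm
    _ = B * G * (M * (Gᴴ * Bᴴ)) := by rw [h2]
    _ = B * (G * M * Gᴴ) * Bᴴ := by simp only [Matrix.mul_assoc]

/-- A positive semidefinite matrix has a positive semidefinite generalized inverse. -/
theorem exists_posSemidef_generalizedInverse {α : Type*} [Fintype α] [DecidableEq α]
    {M : Matrix α α ℂ} (hM : M.PosSemidef) : ∃ G : Matrix α α ℂ, G.PosSemidef ∧ M * G * M = M := by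
  obtain ⟨G, hG⟩ := exists_generalizedInverse M
  refine ⟨G * M * Gᴴ, hM.mul_mul_conjTranspose_same G, ?_⟩
  have h2 := congrArg Matrix.conjTranspose hG
  simp only [Matrix.conjTranspose_mul, hM.isHermitian.eq] at h2
  calc M * (G * M * Gᴴ) * M = (M * G * M) * Gᴴ * M := by simp only [Matrix.mul_assoc]
    _ = M * (Gᴴ * M) := by rw [hG, Matrix.mul_assoc]
    _ = M := h2

theorem exists_range_mulVecLin_eq {α : Type*} [Fintype α] [DecidableEq α]
    (p : Submodule ℂ (α → ℂ)) : ∃ Q : Matrix α α ℂ, LinearMap.range Q.mulVecLin = p := by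
  obtain ⟨q, hq⟩ := p.exists_isCompl
  refine ⟨LinearMap.toMatrix' (p.projection q hq), ?_⟩
  change LinearMap.range (Matrix.toLin' _) = p
  rw [Matrix.toLin'_toMatrix', Submodule.range_projection]

/-- A subspace of prescribed dimension avoiding a given subspace. -/
theorem exists_submodule_disjoint_finrank_eq {V : Type*} [AddCommGroup V] [Module ℂ V]
    [FiniteDimensional ℂ V] {G U : Submodule ℂ V} (hGU : G ≤ U) {d : ℕ}
    (hd : d + finrank ℂ G ≤ finrank ℂ U) :
    ∃ D : Submodule ℂ V, D ≤ U ∧ Disjoint D G ∧ finrank ℂ D = d := by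
  obtain ⟨C, hC⟩ := G.exists_isCompl
  -- Modular law: a complement C of G cuts out a complement of G inside U, where D can be chosen.
  have h1 : G ⊔ C ⊓ U = U := by
    rw [← sup_inf_assoc_of_le C hGU, hC.sup_eq_top, top_inf_eq]
  have h2 := Submodule.finrank_sup_add_finrank_inf_eq G (C ⊓ U)
  have h3 : G ⊓ (C ⊓ U) = ⊥ := by rw [← inf_assoc, hC.inf_eq_bot, bot_inf_eq]
  rw [h1, h3, finrank_bot] at h2
  obtain ⟨b, hb⟩ := exists_linearIndependent_of_le_finrank (R := ℂ) (M := ↥(C ⊓ U)) (n := d)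
    (by omega)
  refine ⟨(Submodule.span ℂ (Set.range b)).map (C ⊓ U).subtype, ?_, ?_, ?_⟩
  · exact (Submodule.map_subtype_le _ _).trans inf_le_right
  · exact (hC.disjoint.symm).mono_left ((Submodule.map_subtype_le _ _).trans inf_le_left)
  · rw [Submodule.finrank_map_subtype_eq, finrank_span_eq_card hb, Fintype.card_fin]

end LinearAlgebra

/-! ### Geometric characterization of index at most one. -/

section PencilIndex

open Module

/-- The index type is left free so that basis vectors can be labelled by the blocks of the Kronecker
form. -/
theorem exists_matrix_basis {n : ℕ} {ι : Type*} [Fintype ι] [DecidableEq ι]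
    (F : Submodule ℂ (Fin n → ℂ)) (h : Fintype.card ι = finrank ℂ F) :
    ∃ T : Matrix (Fin n) ι ℂ, (∀ u, T *ᵥ u = 0 → u = 0) ∧ ∀ x, x ∈ F ↔ ∃ u, T *ᵥ u = x := by
  let L : (ι → ℂ) ≃ₗ[ℂ] F := LinearEquiv.ofFinrankEq _ _ (by rw [finrank_fintype_fun_eq_card, h])
  have hT : ∀ u, LinearMap.toMatrix' (F.subtype ∘ₗ L.toLinearMap) *ᵥ u = L u := fun u => by
    rw [LinearMap.toMatrix'_mulVec]; rfl
  refine ⟨LinearMap.toMatrix' (F.subtype ∘ₗ L.toLinearMap), fun u hu => ?_, fun x => ?_⟩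
  · rw [hT] at hu
    simpa using hu
  · constructor
    · intro hx
      exact ⟨L.symm ⟨x, hx⟩, by rw [hT]; simp⟩
    · rintro ⟨u, rfl⟩
      rw [hT]
      exact (L u).2

theorem isUnit_of_mulVec_eq_zero {n : ℕ} (M : Matrix (Fin n) (Fin n) ℂ)
    (h : ∀ x, M *ᵥ x = 0 → x = 0) : IsUnit M := by
  rw [Matrix.isUnit_iff_isUnit_det, isUnit_iff_ne_zero]
  intro hd
  obtain ⟨v, hv, hv0⟩ := Matrix.exists_mulVec_eq_zero_iff.mpr hd
  exact hv (h v hv0)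

theorem reindex_mulVec {ι κ : Type*} [Fintype ι] [Fintype κ] (e : ι ≃ κ) (M : Matrix ι ι ℂ)
    (v : κ → ℂ) : Matrix.reindex e e M *ᵥ v = (M *ᵥ (v ∘ e)) ∘ e.symm := by
  rw [Matrix.reindex_apply, Matrix.submatrix_mulVec_equiv]
  rfl

/-- If the index of `λ E - A` is at most one, then `ker E ∩ A⁻¹(im E) = 0`. -/
theorem IsPencilIndex.eq_zero_of_le_one {n ν : ℕ} {E A : Matrix (Fin n) (Fin n) ℂ}
    (h : IsPencilIndex E A ν) (hν : ν ≤ 1) (x : Fin n → ℂ) (hx : E *ᵥ x = 0)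
    (hAx : ∃ y, E *ᵥ y = A *ᵥ x) : x = 0 := by
  obtain ⟨p, q, σ, e, S, T, Λ, hS, hT, -, hE, hA, rfl⟩ := h
  have hσ : ∀ j, σ j ≤ 1 := fun j => (Finset.le_sup (Finset.mem_univ j)).trans hν
  have hN : Matrix.blockDiagonal' (fun j => nilpotentJordanBlock (σ j)) = 0 := by
    have : (fun j => nilpotentJordanBlock (σ j)) = 0 := by
      ext j a b
      have h1 := hσ j
      have h2 := b.2
      have h3 : ¬ ((a : ℕ) + 1 = b) := by omega
      simp [nilpotentJordanBlock, h3]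
    rw [this, Matrix.blockDiagonal'_zero]
  rw [hN] at hE
  have hTr : ∀ z, ∃ u, T *ᵥ u = z := fun z =>
    ⟨T⁻¹ *ᵥ z, by rw [Matrix.mulVec_mulVec, Matrix.mul_nonsing_inv _
      ((Matrix.isUnit_iff_isUnit_det _).mp hT), Matrix.one_mulVec]⟩
  obtain ⟨y, hy⟩ := hAx
  obtain ⟨u, rfl⟩ := hTr x
  obtain ⟨w, rfl⟩ := hTr y
  have h1 : (S * E * T) *ᵥ u = 0 := by
    rw [← Matrix.mulVec_mulVec, ← Matrix.mulVec_mulVec, hx, Matrix.mulVec_zero]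
  have h2 : (S * A * T) *ᵥ u = (S * E * T) *ᵥ w := by
    simp only [← Matrix.mulVec_mulVec]
    rw [hy]
  rw [hE, reindex_mulVec] at h1
  rw [hE, hA, reindex_mulVec, reindex_mulVec] at h2
  have hu : u = 0 := by
    ext i
    obtain ⟨j, rfl⟩ := e.surjective i
    rcases j with j | j
    · simpa [Matrix.fromBlocks_mulVec] using congrFun h1 (e (Sum.inl j))
    · simpa [Matrix.fromBlocks_mulVec] using congrFun h2 (e (Sum.inr j))
  rw [hu, Matrix.mulVec_zero]

/-- If `ker E ∩ A⁻¹(im E) = 0`, then `λ E - A` has index at most one. -/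
theorem exists_isPencilIndex_le_one {n : ℕ} {E A : Matrix (Fin n) (Fin n) ℂ}
    (h : ∀ x, E *ᵥ x = 0 → (∃ y, E *ᵥ y = A *ᵥ x) → x = 0) :
    ∃ ν, IsPencilIndex E A ν ∧ ν ≤ 1 := by
  set K := LinearMap.ker E.mulVecLin with hK
  set I := LinearMap.range E.mulVecLin with hI
  set F := I.comap A.mulVecLin with hF
  have hdisj : Disjoint F K := by
    rw [Submodule.disjoint_def]
    intro x hxF hxK
    obtain ⟨y, hy⟩ := hxF
    exact h x hxK ⟨y, hy⟩
  -- A is injective on ker E and A(ker E) meets im E only in 0, so rank-nullity for E makes the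
  -- dimensions add up to n.
  have hsum : I ⊔ K.map A.mulVecLin = ⊤ := by
    apply Submodule.eq_top_of_disjoint
    · have h1 : finrank ℂ (K.map A.mulVecLin) = finrank ℂ K := by
        rw [← LinearMap.range_domRestrict]
        apply LinearMap.finrank_range_of_inj
        rw [← LinearMap.ker_eq_bot, Submodule.eq_bot_iff]
        rintro ⟨x, hxK⟩ hx
        have hAx : A *ᵥ x = 0 := hx
        exact Subtype.ext (h x hxK ⟨0, by rw [Matrix.mulVec_zero, hAx]⟩)
      rw [h1, ← LinearMap.finrank_range_add_finrank_ker E.mulVecLin]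
    · rw [Submodule.disjoint_def]
      rintro _ ⟨y, rfl⟩ ⟨k, hk, hky⟩
      rw [h k hk ⟨y, hky.symm⟩, map_zero] at hky
      exact hky.symm
  have hcod : ∀ x : Fin n → ℂ, ∃ f ∈ F, ∃ k ∈ K, x = f + k := by
    intro x
    obtain ⟨_, ⟨y, rfl⟩, _, ⟨k, hk, rfl⟩, hy⟩ :=
      Submodule.mem_sup.mp (hsum ▸ Submodule.mem_top : A.mulVecLin x ∈ I ⊔ K.map A.mulVecLin)
    refine ⟨x - k, ⟨y, ?_⟩, k, hk, by simp⟩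
    rw [map_sub, ← hy, add_sub_cancel_right]
  have hcompl : IsCompl F K := by
    refine ⟨hdisj, codisjoint_iff.mpr (Submodule.eq_top_iff'.mpr fun x => ?_)⟩
    obtain ⟨f, hf, k, hk, rfl⟩ := hcod x
    exact Submodule.add_mem_sup hf hk
  have hdim := Submodule.finrank_add_eq_of_isCompl hcompl
  rw [finrank_fin_fun] at hdim
  obtain ⟨T₁, hT₁, hT₁F⟩ := exists_matrix_basis (ι := Fin (finrank ℂ F)) F (by simp)
  obtain ⟨T₂, hT₂, hT₂K⟩ :=
    exists_matrix_basis (ι := Σ _ : Fin (finrank ℂ K), Fin 1) K (by simp)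
  -- A F ⊆ im E = E F, since ker E is a complement of F.
  have hΛ : ∃ Λ : Matrix (Fin (finrank ℂ F)) (Fin (finrank ℂ F)) ℂ, A * T₁ = E * T₁ * Λ := by
    have : ∀ j, ∃ l, (E * T₁) *ᵥ l = (A * T₁) *ᵥ Pi.single j 1 := by
      intro j
      obtain ⟨y, hy⟩ := (hT₁F (T₁ *ᵥ Pi.single j 1)).mpr ⟨_, rfl⟩
      obtain ⟨f, hf, k, hk, rfl⟩ := hcod y
      obtain ⟨l, rfl⟩ := (hT₁F f).mp hf
      refine ⟨l, ?_⟩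
      have hk' : E.mulVecLin k = 0 := hk
      rw [map_add, hk', add_zero] at hy
      simpa only [Matrix.mulVecLin_apply, Matrix.mulVec_mulVec] using hy
    choose l hl using this
    refine ⟨Matrix.of fun i j => l j i, Matrix.ext_of_mulVec_single fun j => ?_⟩
    have hlj : (Matrix.of fun i j => l j i) *ᵥ Pi.single j 1 = l j := by
      ext i
      simp
    rw [← hl, ← Matrix.mulVec_mulVec _ (E * T₁), hlj]
  obtain ⟨Λ, hΛ⟩ := hΛ
  have hET₂ : E * T₂ = 0 := by
    apply Matrix.ext_of_mulVec_single
    intro j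
    have : T₂ *ᵥ Pi.single j 1 ∈ K := (hT₂K _).mpr ⟨_, rfl⟩
    rw [← Matrix.mulVec_mulVec, Matrix.zero_mulVec]
    exact this
  set T := Matrix.fromCols T₁ T₂ with hTdef
  -- E T = C diag(1, 0) and A T = C diag(Λ, 1), so C⁻¹ is the left transformation to Kronecker form.
  set C := Matrix.fromCols (E * T₁) (A * T₂) with hCdef
  have hT : ∀ u, T *ᵥ u = 0 → u = 0 := by
    intro u hu
    rw [hTdef, Matrix.fromCols_mulVec] at hu
    have h1 := (hT₁F (T₁ *ᵥ (u ∘ Sum.inl))).mpr ⟨_, rfl⟩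
    have h2 := (hT₂K (T₂ *ᵥ (u ∘ Sum.inr))).mpr ⟨_, rfl⟩
    have h3 : T₁ *ᵥ (u ∘ Sum.inl) = 0 := by
      refine Submodule.disjoint_def.mp hdisj _ h1 ?_
      rw [eq_neg_of_add_eq_zero_left hu]
      exact K.neg_mem h2
    rw [h3, zero_add] at hu
    ext (i | i)
    · exact congrFun (hT₁ _ h3) i
    · exact congrFun (hT₂ _ hu) i
  have hC : ∀ u, C *ᵥ u = 0 → u = 0 := by
    intro u hu
    rw [hCdef, Matrix.fromCols_mulVec, ← Matrix.mulVec_mulVec, ← Matrix.mulVec_mulVec] at hu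
    have h1 := (hT₁F (T₁ *ᵥ (u ∘ Sum.inl))).mpr ⟨_, rfl⟩
    have h2 := (hT₂K (T₂ *ᵥ (u ∘ Sum.inr))).mpr ⟨_, rfl⟩
    have h3 : T₂ *ᵥ (u ∘ Sum.inr) = 0 := by
      refine h _ h2 ⟨-(T₁ *ᵥ (u ∘ Sum.inl)), ?_⟩
      rw [Matrix.mulVec_neg, eq_neg_of_add_eq_zero_left hu, neg_neg]
    rw [h3, Matrix.mulVec_zero, add_zero] at hu
    have h4 := Submodule.disjoint_def.mp hdisj _ h1 hu
    ext (i | i)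
    · exact congrFun (hT₁ _ h4) i
    · exact congrFun (hT₂ _ h3) i
  let e : (Fin (finrank ℂ F) ⊕ (Σ _ : Fin (finrank ℂ K), Fin 1)) ≃ Fin n :=
    Fintype.equivOfCardEq (by simpa using hdim)
  have hsub : ∀ M : Matrix (Fin n) (Fin (finrank ℂ F) ⊕ (Σ _ : Fin (finrank ℂ K), Fin 1)) ℂ,
      (∀ u, M *ᵥ u = 0 → u = 0) → IsUnit (M.submatrix id e.symm) := by
    intro M hM
    apply isUnit_of_mulVec_eq_zero
    intro x hx
    rw [Matrix.submatrix_mulVec_equiv] at hx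
    have := hM _ hx
    ext i
    simpa using congrFun this (e.symm i)
  have hTu := hsub T hT
  have hCu := hsub C hC
  have hCC := Matrix.nonsing_inv_mul _ ((Matrix.isUnit_iff_isUnit_det _).mp hCu)
  have hmul : ∀ (M : Matrix (Fin n) (Fin n) ℂ) (D), M * T = C * D →
      (C.submatrix id e.symm)⁻¹ * M * T.submatrix id e.symm = Matrix.reindex e e D := by
    intro M D hMD
    have h1 : M * T.submatrix id e.symm = C.submatrix id e.symm * Matrix.reindex e e D := by
      rw [Matrix.reindex_apply, Matrix.submatrix_mul_equiv, ← hMD]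
      rfl
    rw [Matrix.mul_assoc, h1, ← Matrix.mul_assoc, hCC, Matrix.one_mul]
  refine ⟨_, ⟨finrank ℂ F, finrank ℂ K, fun _ => 1, e, (C.submatrix id e.symm)⁻¹,
    T.submatrix id e.symm, Λ, ?_, hTu, fun _ => le_rfl, hmul _ _ ?_, hmul _ _ ?_, rfl⟩, ?_⟩
  · exact (Matrix.isUnit_nonsing_inv_iff).mpr hCu
  · have hN : Matrix.blockDiagonal' (fun _ : Fin (finrank ℂ K) => nilpotentJordanBlock 1) = 0 := by
      have : (fun _ : Fin (finrank ℂ K) => nilpotentJordanBlock 1) = 0 := by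
        ext j a b
        simp [nilpotentJordanBlock]
      rw [this, Matrix.blockDiagonal'_zero]
    rw [hN, hTdef, hCdef, Matrix.mul_fromCols, Matrix.fromCols_mul_fromBlocks, hET₂]
    simp
  · rw [hTdef, hCdef, Matrix.mul_fromCols, Matrix.fromCols_mul_fromBlocks, hΛ]
    simp
  · exact Finset.sup_le fun _ _ => le_rfl

end PencilIndex

/-! ### Consequences of skew J and semidefinite E, R. -/

section Dissipative

variable {n : ℕ} {E J R : Matrix (Fin n) (Fin n) ℂ}

theorem re_star_dotProduct_skew (hJ : J = -Jᴴ) (x : Fin n → ℂ) : (star x ⬝ᵥ J *ᵥ x).re = 0 := by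
  have hJ' : Jᴴ = -J := by
    conv_rhs => rw [hJ]
    rw [neg_neg]
  have h : star (star x ⬝ᵥ J *ᵥ x) = -(star x ⬝ᵥ J *ᵥ x) := by
    rw [← Matrix.star_dotProduct, star_dotProduct_mulVec_eq, hJ', Matrix.neg_mulVec, star_neg,
      neg_dotProduct, neg_neg]
  have h2 := congrArg Complex.re h
  simp only [Complex.star_def, Complex.conj_re, Complex.neg_re] at h2
  linarith

theorem Matrix.PosSemidef.mulVec_eq_zero_of_re (hR : R.PosSemidef) {x : Fin n → ℂ}
    (h : (star x ⬝ᵥ R *ᵥ x).re = 0) : R *ᵥ x = 0 := by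
  rw [← hR.dotProduct_mulVec_zero_iff]
  refine Complex.ext h ?_
  exact (Complex.nonneg_iff.mp (hR.dotProduct_mulVec_nonneg x)).2.symm

theorem Matrix.PosSemidef.re_nonneg (hR : R.PosSemidef) (x : Fin n → ℂ) :
    0 ≤ (star x ⬝ᵥ R *ᵥ x).re :=
  (Complex.nonneg_iff.mp (hR.dotProduct_mulVec_nonneg x)).1

theorem Matrix.PosSemidef.add_mulVec_eq_zero {M N : Matrix (Fin n) (Fin n) ℂ}
    (hM : M.PosSemidef) (hN : N.PosSemidef) {x : Fin n → ℂ} (h : (M + N) *ᵥ x = 0) :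
    M *ᵥ x = 0 ∧ N *ᵥ x = 0 := by
  have h1 : (star x ⬝ᵥ M *ᵥ x).re + (star x ⬝ᵥ N *ᵥ x).re = 0 := by
    rw [← Complex.add_re, ← dotProduct_add, ← Matrix.add_mulVec, h]
    simp
  have h2 := hM.re_nonneg x
  have h3 := hN.re_nonneg x
  exact ⟨hM.mulVec_eq_zero_of_re (by linarith), hN.mulVec_eq_zero_of_re (by linarith)⟩

/-- The skew part contributes nothing to the real part of xᴴ(J - R)x, which is therefore -xᴴ R x. -/
theorem mulVec_eq_zero_of_dissipative (hJ : J = -Jᴴ) (hR : R.PosSemidef) {x : Fin n → ℂ}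
    (h : star x ⬝ᵥ (J - R) *ᵥ x = 0) : R *ᵥ x = 0 := by
  apply hR.mulVec_eq_zero_of_re
  have h1 := congrArg Complex.re h
  rw [Matrix.sub_mulVec, dotProduct_sub, Complex.sub_re, re_star_dotProduct_skew hJ] at h1
  simpa using h1

/-- Eigenvectors of a dissipative pencil for eigenvalues in the closed right half plane. -/
theorem mulVec_eq_zero_of_eigenvector (hE : E.PosSemidef) (hJ : J = -Jᴴ) (hR : R.PosSemidef)
    {z : ℂ} (hz : 0 ≤ z.re) {x : Fin n → ℂ} (h : (J - R) *ᵥ x = z • (E *ᵥ x)) :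
    R *ᵥ x = 0 ∧ (z.re = 0 ∨ E *ᵥ x = 0) := by
  -- The real part of the equation tested with x reads -xᴴ R x = Re z · xᴴ E x; the sides have
  -- opposite signs, so both vanish.
  have h1 := congrArg (fun v => (star x ⬝ᵥ v).re) h
  have him : (star x ⬝ᵥ E *ᵥ x).im = 0 :=
    (Complex.nonneg_iff.mp (hE.dotProduct_mulVec_nonneg x)).2.symm
  simp only [Matrix.sub_mulVec, dotProduct_sub, Complex.sub_re, re_star_dotProduct_skew hJ,
    dotProduct_smul, smul_eq_mul, Complex.mul_re, him, mul_zero, sub_zero, zero_sub] at h1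
  have h2 := hE.re_nonneg x
  have h3 := hR.re_nonneg x
  have h4 := mul_nonneg hz h2
  refine ⟨hR.mulVec_eq_zero_of_re (by linarith), ?_⟩
  have h5 : z.re * (star x ⬝ᵥ E *ᵥ x).re = 0 := by linarith
  exact (mul_eq_zero.mp h5).imp_right hE.mulVec_eq_zero_of_re

/-- On ker R both matrices reduce to J and Jᴴ = -J. This is what passes between a pencil and its
adjoint. -/
theorem conjTranspose_mulVec_of_mulVec_eq_zero (hJ : J = -Jᴴ) (hR : R.PosSemidef)
    {x : Fin n → ℂ} (h : R *ᵥ x = 0) : (J - R)ᴴ *ᵥ x = -((J - R) *ᵥ x) := by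
  have hJ' : Jᴴ = -J := by
    conv_rhs => rw [hJ]
    rw [neg_neg]
  rw [Matrix.conjTranspose_sub, hR.isHermitian.eq, hJ', Matrix.sub_mulVec, Matrix.sub_mulVec, h,
    Matrix.neg_mulVec]
  simp

/-- The dual form of the index condition `ker E ∩ A⁻¹(im E) = 0` for dissipative pencils. -/
theorem IsPencilIndex.eq_zero_of_conjTranspose {ν : ℕ} (hE : E.PosSemidef) (hJ : J = -Jᴴ)
    (hR : R.PosSemidef) (h : IsPencilIndex E (J - R) ν) (hν : ν ≤ 1) {x w : Fin n → ℂ}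
    (hx : E *ᵥ x = 0) (hw : (J - R)ᴴ *ᵥ x = E *ᵥ w) : x = 0 := by
  have h1 : R *ᵥ x = 0 := by
    apply mulVec_eq_zero_of_dissipative hJ hR
    rw [star_dotProduct_mulVec_eq, hw]
    have := star_dotProduct_mulVec_eq E w x
    rw [hx, hE.isHermitian.eq] at this
    simpa using this.symm
  refine h.eq_zero_of_le_one hν x hx ⟨-w, ?_⟩
  rw [Matrix.mulVec_neg, ← hw, conjTranspose_mulVec_of_mulVec_eq_zero hJ hR h1, neg_neg]

end Dissipative

/-! ### Geometric meaning of the rank conditions. -/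

section RankConditions

open Module

variable {n m : ℕ} {E J R : Matrix (Fin n) (Fin n) ℂ} {B : Matrix (Fin n) (Fin m) ℂ}
  {k₁ k₂ k₃ k₄ k₅ : ℕ}

theorem IsLeftNullBasis.conjTranspose_mul_eq_zero {T₁ : Matrix (Fin n) (Fin k₁) ℂ}
    (hT₁ : IsLeftNullBasis B T₁) : T₁ᴴ * B = 0 := by
  apply Matrix.ext_of_mulVec_single
  intro j
  rw [← Matrix.mulVec_mulVec, Matrix.zero_mulVec, hT₁.conjTranspose_mulVec_eq_zero_iff]
  exact ⟨_, rfl⟩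

theorem rank_fromCols_zero {α β γ : Type*} [Fintype α] [Fintype β] [Fintype γ]
    (M : Matrix α β ℂ) : (Matrix.fromCols M (0 : Matrix α γ ℂ)).rank = M.rank := by
  suffices h : LinearMap.range (Matrix.fromCols M (0 : Matrix α γ ℂ)).mulVecLin =
      LinearMap.range M.mulVecLin by
    rw [Matrix.rank, h, Matrix.rank]
  ext v
  simp only [LinearMap.mem_range, Matrix.mulVecLin_apply]
  constructor
  · rintro ⟨y, rfl⟩
    exact ⟨y ∘ Sum.inl, by simp [Matrix.fromCols_mulVec]⟩
  · rintro ⟨y, rfl⟩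
    exact ⟨Sum.elim y 0, by simp [Matrix.fromCols_mulVec]⟩

theorem range_mulVecLin_le_fromCols_right (E : Matrix (Fin n) (Fin n) ℂ)
    (B : Matrix (Fin n) (Fin m) ℂ) :
    LinearMap.range B.mulVecLin ≤ LinearMap.range (Matrix.fromCols E B).mulVecLin := by
  rintro _ ⟨y, rfl⟩
  exact ⟨Sum.elim 0 y, by simp [Matrix.fromCols_mulVec]⟩

/-- T₁ᴴ annihilates exactly im B inside im [E, B]. Hence rank [E, B] - rank B is the dimension of
E(ker Bᴴ). -/
theorem rank_mul_leftNullBasis_add_rank (hE : E.IsHermitian) {T₁ : Matrix (Fin n) (Fin k₁) ℂ}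
    (hT₁ : IsLeftNullBasis B T₁) :
    (E * T₁).rank + B.rank = (Matrix.fromCols E B).rank := by
  have h := rank_mul_add_finrank_inf T₁ᴴ (Matrix.fromCols E B)
  have hker : LinearMap.ker T₁ᴴ.mulVecLin = LinearMap.range B.mulVecLin := by
    ext x
    exact hT₁.conjTranspose_mulVec_eq_zero_iff x
  rw [hker, inf_eq_right.mpr (range_mulVecLin_le_fromCols_right E B), Matrix.mul_fromCols,
    hT₁.conjTranspose_mul_eq_zero, rank_fromCols_zero, ← Matrix.rank_conjTranspose,
    Matrix.conjTranspose_mul, Matrix.conjTranspose_conjTranspose, hE.eq] at h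
  exact h

theorem rank_pencil_eq_iff (s : ℂ) :
    (Matrix.fromCols (J - R - s • E) B).rank = n ↔
      ∀ x, (J - R - s • E)ᴴ *ᵥ x = 0 → Bᴴ *ᵥ x = 0 → x = 0 := by
  rw [rank_eq_iff_left_kernel]
  simp only [conjTranspose_fromCols_mulVec_eq_zero_iff, and_imp]

/-- The two rank conditions on `E`, `J - R`, `B` together say that `(J - R)ᴴ` is injective on
`N = ker E ∩ ker Bᴴ` and maps it to a complement of `E (ker Bᴴ)`. -/
theorem rank_conditions_iff (hE : E.IsHermitian)
    {T₁ : Matrix (Fin n) (Fin k₁) ℂ} (hT₁ : IsLeftNullBasis B T₁)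
    {T₂ : Matrix (Fin n) (Fin k₂) ℂ} (hT₂ : IsLeftNullBasis (Matrix.fromCols E B) T₂)
    {S₃ : Matrix (Fin n) (Fin k₃) ℂ} (hS₃ : IsRightNullBasis (T₂ᴴ * (J - R)) S₃) :
    ((Matrix.fromCols (Matrix.fromCols E (J - R)) B).rank = n ∧
      ((T₁ᴴ * E * S₃).rank : ℤ) = ((Matrix.fromCols E B).rank : ℤ) - (B.rank : ℤ)) ↔
    ∀ x w, E *ᵥ x = 0 → Bᴴ *ᵥ x = 0 → Bᴴ *ᵥ w = 0 → (J - R)ᴴ *ᵥ x = E *ᵥ w → x = 0 := by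
  have hN : ∀ x, (∃ y, T₂ *ᵥ y = x) ↔ E *ᵥ x = 0 ∧ Bᴴ *ᵥ x = 0 := fun x => by
    rw [hT₂.exists_mulVec_iff, conjTranspose_fromCols_mulVec_eq_zero_iff, hE.eq]
  have h1 : (Matrix.fromCols (Matrix.fromCols E (J - R)) B).rank = n ↔
      ∀ x, E *ᵥ x = 0 → Bᴴ *ᵥ x = 0 → (J - R)ᴴ *ᵥ x = 0 → x = 0 := by
    rw [rank_eq_iff_left_kernel]
    simp only [conjTranspose_fromCols_mulVec_eq_zero_iff, hE.eq]
    exact forall_congr' fun x => by tauto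
  -- The kernel of S₃ᴴ is (J - R)ᴴ N, so the rank equality says that S₃ᴴ is injective on E(ker Bᴴ),
  -- that is, E(ker Bᴴ) ∩ (J - R)ᴴ N = 0.
  have h2 : ((T₁ᴴ * E * S₃).rank : ℤ) = ((Matrix.fromCols E B).rank : ℤ) - (B.rank : ℤ) ↔
      ∀ x w, E *ᵥ x = 0 → Bᴴ *ᵥ x = 0 → Bᴴ *ᵥ w = 0 → (J - R)ᴴ *ᵥ x = E *ᵥ w → E *ᵥ w = 0 := by
    have h3 := rank_mul_leftNullBasis_add_rank hE hT₁
    have h4 : (T₁ᴴ * E * S₃).rank = (S₃ᴴ * (E * T₁)).rank := by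
      rw [← Matrix.rank_conjTranspose]
      simp [Matrix.conjTranspose_mul, hE.eq]
    have h5 : ((T₁ᴴ * E * S₃).rank : ℤ) = ((Matrix.fromCols E B).rank : ℤ) - (B.rank : ℤ) ↔
        (S₃ᴴ * (E * T₁)).rank = (E * T₁).rank := by
      rw [h4]; omega
    rw [h5, rank_mul_eq_iff]
    simp only [hS₃.conjTranspose_mulVec_eq_zero_iff, Matrix.conjTranspose_mul,
      Matrix.conjTranspose_conjTranspose, ← Matrix.mulVec_mulVec]
    constructor
    · intro h x w hEx hBx hBw hxw
      obtain ⟨a, rfl⟩ := (hT₁.exists_mulVec_iff w).mpr hBw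
      obtain ⟨y, rfl⟩ := (hN x).mpr ⟨hEx, hBx⟩
      exact h a ⟨y, hxw⟩
    · rintro h a ⟨y, hy⟩
      obtain ⟨h6, h7⟩ := (hN _).mp ⟨y, rfl⟩
      exact h _ _ h6 h7 ((hT₁.exists_mulVec_iff _).mp ⟨a, rfl⟩) hy
  rw [h1, h2]
  constructor
  · rintro ⟨h3, h4⟩ x w hEx hBx hBw hxw
    exact h3 x hEx hBx (by rw [hxw, h4 x w hEx hBx hBw hxw])
  · intro h
    refine ⟨fun x hEx hBx hx => h x 0 hEx hBx (by simp) (by rw [hx, Matrix.mulVec_zero]), ?_⟩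
    intro x w hEx hBx hBw hxw
    rw [← hxw, h x w hEx hBx hBw hxw, Matrix.mulVec_zero]

end RankConditions

/-! ### Necessity, rank bounds and construction of the feedback. -/

section ClosedLoop

open Module

variable {n m : ℕ} {E J R : Matrix (Fin n) (Fin n) ℂ} {B : Matrix (Fin n) (Fin m) ℂ}
  {K F_S F_H : Matrix (Fin m) (Fin m) ℂ} {k₁ k₄ k₅ : ℕ}

theorem add_feedback_mulVec (M : Matrix (Fin n) (Fin n) ℂ) (K : Matrix (Fin m) (Fin m) ℂ)
    {x : Fin n → ℂ} (hx : Bᴴ *ᵥ x = 0) : (M + B * K * Bᴴ) *ᵥ x = M *ᵥ x := by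
  rw [Matrix.add_mulVec, ← Matrix.mulVec_mulVec, hx, Matrix.mulVec_zero, add_zero]

theorem add_feedback_conjTranspose_mulVec (M : Matrix (Fin n) (Fin n) ℂ)
    (K : Matrix (Fin m) (Fin m) ℂ) {x : Fin n → ℂ} (hx : Bᴴ *ᵥ x = 0) :
    (M + B * K * Bᴴ)ᴴ *ᵥ x = Mᴴ *ᵥ x := by
  have h : (M + B * K * Bᴴ)ᴴ = Mᴴ + B * Kᴴ * Bᴴ := by
    simp [Matrix.conjTranspose_mul, Matrix.mul_assoc]
  rw [h, add_feedback_mulVec _ _ hx]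

theorem closedLoop_eq (J R : Matrix (Fin n) (Fin n) ℂ) (B : Matrix (Fin n) (Fin m) ℂ)
    (F_S F_H : Matrix (Fin m) (Fin m) ℂ) :
    J + B * F_S * Bᴴ - (R + B * F_H * Bᴴ) = J - R + B * (F_S - F_H) * Bᴴ := by
  rw [Matrix.mul_sub, Matrix.sub_mul]
  abel

theorem add_feedback_skew (hJ : J = -Jᴴ) (hF : F_S = -F_Sᴴ) :
    J + B * F_S * Bᴴ = -(J + B * F_S * Bᴴ)ᴴ := by
  rw [Matrix.conjTranspose_add, neg_add, ← hJ]
  congr 1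
  conv_lhs => rw [hF]
  simp [Matrix.conjTranspose_mul, Matrix.mul_assoc]

/-- As x and w lie in ker Bᴴ, the hypotheses hold verbatim for the closed loop, whose index is at
most one. -/
theorem IsStabilizingFeedback.dual_index_condition (hJ : J = -Jᴴ)
    (h : IsStabilizingFeedback E J R B K F_S F_H) {x w : Fin n → ℂ} (hEx : E *ᵥ x = 0)
    (hBx : Bᴴ *ᵥ x = 0) (hBw : Bᴴ *ᵥ w = 0) (hxw : (J - R)ᴴ *ᵥ x = E *ᵥ w) : x = 0 := by
  obtain ⟨hS, -, -, ⟨ν, hν, hν1⟩, -, hE', hR'⟩ := h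
  refine hν.eq_zero_of_conjTranspose (w := w) hE' (add_feedback_skew hJ hS) hR' hν1 ?_ ?_
  · rw [add_feedback_mulVec _ _ hBx, hEx]
  · rw [closedLoop_eq, add_feedback_conjTranspose_mulVec _ _ hBx, add_feedback_mulVec _ _ hBw, hxw]

/-- By regularity and stability the closed-loop pencil is invertible on the imaginary axis, and a
left null vector of [J - R - sE, B] would be one of that pencil. -/
theorem IsStabilizingFeedback.rank_pencil_eq (h : IsStabilizingFeedback E J R B K F_S F_H)
    {s : ℂ} (hs : s.re = 0) : (Matrix.fromCols (J - R - s • E) B).rank = n := by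
  obtain ⟨-, -, ⟨z, hz⟩, -, hstab, -, -⟩ := h
  rw [rank_pencil_eq_iff]
  intro x hx hBx
  set Eh := E + B * K * Bᴴ
  set Ah := J + B * F_S * Bᴴ - (R + B * F_H * Bᴴ) with hAh
  have hrank : (s • Eh - Ah).rank = n := by
    by_contra hne
    have hzr : (z • Eh - Ah).rank = n := by
      have := Matrix.rank_of_isUnit _
        ((Matrix.isUnit_iff_isUnit_det _).mpr (isUnit_iff_ne_zero.mpr hz))
      simpa using this
    have hlt : (s • Eh - Ah).rank < n :=
      lt_of_le_of_ne ((Matrix.rank_le_width _).trans le_rfl) hne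
    have := hstab s ⟨z, by rw [hzr]; exact hlt⟩
    rw [hs] at this
    exact lt_irrefl _ this
  refine (rank_eq_iff_left_kernel _).mp hrank x ?_
  have hsplit : s • Eh - Ah = -(J - R - s • E + B * (F_S - F_H - s • K) * Bᴴ) := by
    rw [hAh, closedLoop_eq]
    simp only [Eh, Matrix.mul_sub, Matrix.sub_mul, smul_add, Matrix.mul_smul, Matrix.smul_mul]
    abel
  rw [hsplit, Matrix.conjTranspose_neg, Matrix.neg_mulVec,
    add_feedback_conjTranspose_mulVec _ _ hBx, hx, neg_zero]

theorem le_rank_add_feedback (hE : E.IsHermitian) {T₁ : Matrix (Fin n) (Fin k₁) ℂ}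
    (hT₁ : IsLeftNullBasis B T₁) (K : Matrix (Fin m) (Fin m) ℂ) :
    (E * T₁).rank ≤ (E + B * K * Bᴴ).rank := by
  have h1 : T₁ᴴ * (E + B * K * Bᴴ) = (E * T₁)ᴴ := by
    rw [Matrix.mul_add, Matrix.mul_assoc B, ← Matrix.mul_assoc T₁ᴴ B,
      hT₁.conjTranspose_mul_eq_zero, Matrix.zero_mul, add_zero, Matrix.conjTranspose_mul, hE.eq]
  rw [← Matrix.rank_conjTranspose, ← h1]
  exact Matrix.rank_mul_le_right _ _

theorem IsRightNullBasis.fromRows_iff {S₄ : Matrix (Fin n) (Fin k₄) ℂ}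
    (hS₄ : IsRightNullBasis (Matrix.fromRows E Bᴴ) S₄) (x : Fin n → ℂ) :
    (∃ y, S₄ *ᵥ y = x) ↔ E *ᵥ x = 0 ∧ Bᴴ *ᵥ x = 0 := by
  rw [hS₄.exists_mulVec_iff, fromRows_mulVec_eq_zero_iff]

/-- The index condition keeps the range of E + B K Bᴴ away from (J - R) N, the kernel of T₅ᴴ, so T₅ᴴ
preserves its rank; that range lies in im [E, B]. -/
theorem IsStabilizingFeedback.rank_le (h : IsStabilizingFeedback E J R B K F_S F_H)
    {S₄ : Matrix (Fin n) (Fin k₄) ℂ} (hS₄ : IsRightNullBasis (Matrix.fromRows E Bᴴ) S₄)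
    {T₅ : Matrix (Fin n) (Fin k₅) ℂ} (hT₅ : IsLeftNullBasis ((J - R) * S₄) T₅) :
    (E + B * K * Bᴴ).rank ≤ (T₅ᴴ * Matrix.fromCols E B).rank := by
  obtain ⟨-, -, -, ⟨ν, hν, hν1⟩, -, -, -⟩ := h
  have h1 : (T₅ᴴ * (E + B * K * Bᴴ)).rank = (E + B * K * Bᴴ).rank := by
    rw [rank_mul_eq_iff]
    intro x hx
    obtain ⟨y, hy⟩ := (hT₅.conjTranspose_mulVec_eq_zero_iff _).mp hx
    rw [← Matrix.mulVec_mulVec] at hy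
    obtain ⟨hE0, hB0⟩ := (hS₄.fromRows_iff _).mp ⟨y, rfl⟩
    have h2 : S₄ *ᵥ y = 0 := by
      refine hν.eq_zero_of_le_one hν1 _ ?_ ⟨x, ?_⟩
      · rw [add_feedback_mulVec _ _ hB0, hE0]
      · rw [closedLoop_eq, add_feedback_mulVec _ _ hB0, hy]
    rw [← hy, h2, Matrix.mulVec_zero]
  have h3 : T₅ᴴ * (E + B * K * Bᴴ) =
      T₅ᴴ * Matrix.fromCols E B * Matrix.fromRows (1 : Matrix (Fin n) (Fin n) ℂ) (K * Bᴴ) := by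
    rw [Matrix.mul_assoc T₅ᴴ, Matrix.fromCols_mul_fromRows, Matrix.mul_one, Matrix.mul_assoc B]
  rw [← h1, h3]
  exact Matrix.rank_mul_le_left _ _

/-- Damping injection `F_H = 1` stabilizes the closed loop as soon as `E + B K Bᴴ ≥ 0` has a range
that meets `(J - R) (ker E ∩ ker Bᴴ)` only in `0`. -/
theorem isStabilizingFeedback_of_range (hE : E.PosSemidef) (hJ : J = -Jᴴ) (hR : R.PosSemidef)
    (hK : (E + B * K * Bᴴ).PosSemidef)
    (h3 : ∀ s : ℂ, s.re = 0 → (Matrix.fromCols (J - R - s • E) B).rank = n)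
    (hrange : ∀ x y, E *ᵥ x = 0 → Bᴴ *ᵥ x = 0 → (E + B * K * Bᴴ) *ᵥ y = (J - R) *ᵥ x → x = 0) :
    IsStabilizingFeedback E J R B K 0 1 := by
  have hR' : (R + B * (1 : Matrix (Fin m) (Fin m) ℂ) * Bᴴ).PosSemidef := by
    rw [Matrix.mul_one]
    exact hR.add (Matrix.posSemidef_self_mul_conjTranspose B)
  have hJ' : J + B * (0 : Matrix (Fin m) (Fin m) ℂ) * Bᴴ =
      -(J + B * (0 : Matrix (Fin m) (Fin m) ℂ) * Bᴴ)ᴴ := add_feedback_skew hJ (by simp)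
  have hRB : ∀ x, (R + B * (1 : Matrix (Fin m) (Fin m) ℂ) * Bᴴ) *ᵥ x = 0 →
      R *ᵥ x = 0 ∧ Bᴴ *ᵥ x = 0 := by
    intro x hx
    rw [Matrix.mul_one] at hx
    obtain ⟨h1, h2⟩ := hR.add_mulVec_eq_zero (Matrix.posSemidef_self_mul_conjTranspose B) hx
    exact ⟨h1, (Matrix.self_mul_conjTranspose_mulVec_eq_zero B x).mp h2⟩
  have hker : ∀ s : ℂ, s.re = 0 → ∀ x, R *ᵥ x = 0 → Bᴴ *ᵥ x = 0 →
      (J - R) *ᵥ x = s • (E *ᵥ x) → x = 0 := by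
    intro s hs x hRx hBx hx
    refine (rank_pencil_eq_iff s).mp (h3 s hs) x ?_ hBx
    have hss : star s = -s := by
      apply Complex.ext <;> simp [hs]
    rw [Matrix.conjTranspose_sub, Matrix.sub_mulVec,
      conjTranspose_mulVec_of_mulVec_eq_zero hJ hR hRx, hx, Matrix.conjTranspose_smul,
      hE.isHermitian.eq, hss, Matrix.smul_mulVec, neg_smul, sub_self]
  have heig : ∀ z : ℂ, 0 ≤ z.re → ∀ x,
      (J + B * (0 : Matrix (Fin m) (Fin m) ℂ) * Bᴴ -
        (R + B * (1 : Matrix (Fin m) (Fin m) ℂ) * Bᴴ)) *ᵥ x =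
      z • ((E + B * K * Bᴴ) *ᵥ x) → x = 0 := by
    intro z hz x hx
    obtain ⟨h1, h2⟩ := mulVec_eq_zero_of_eigenvector hK hJ' hR' hz hx
    obtain ⟨hRx, hBx⟩ := hRB x h1
    rw [add_feedback_mulVec _ _ hBx] at h2
    rw [closedLoop_eq, add_feedback_mulVec _ _ hBx, add_feedback_mulVec _ _ hBx] at hx
    rcases h2 with h2 | h2
    · exact hker z h2 x hRx hBx hx
    -- Here E x = 0, so (J - R) x = 0 whatever z is, and the rank condition at s = 0 applies.
    · exact hker 0 (by simp) x hRx hBx (by rw [hx, h2, smul_zero, smul_zero])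
  -- Regularity is witnessed at 0, which lies in the closed right half plane and so is not an
  -- eigenvalue.
  refine ⟨by simp, by simp, ⟨0, ?_⟩, ?_, ?_, hK, hR'⟩
  · intro hd
    obtain ⟨v, hv, hv0⟩ := Matrix.exists_mulVec_eq_zero_iff.mpr hd
    rw [zero_smul, zero_sub, Matrix.neg_mulVec, neg_eq_zero] at hv0
    exact hv (heig 0 (by simp) v (by rw [hv0, zero_smul]))
  · apply exists_isPencilIndex_le_one
    rintro x hx ⟨y, hy⟩
    have h1 : (R + B * (1 : Matrix (Fin m) (Fin m) ℂ) * Bᴴ) *ᵥ x = 0 := by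
      apply mulVec_eq_zero_of_dissipative hJ' hR'
      rw [← hy, star_dotProduct_mulVec_eq, hK.isHermitian.eq, hx]
      simp
    obtain ⟨-, hBx⟩ := hRB x h1
    rw [add_feedback_mulVec _ _ hBx] at hx
    rw [closedLoop_eq, add_feedback_mulVec _ _ hBx] at hy
    exact hrange x y hx hBx hy
  · rintro z ⟨α, hα⟩
    by_contra hz
    have hlt := hα.trans_le (Matrix.rank_le_width _)
    have hdet : (z • (E + B * K * Bᴴ) -
        (J + B * (0 : Matrix (Fin m) (Fin m) ℂ) * Bᴴ -
          (R + B * (1 : Matrix (Fin m) (Fin m) ℂ) * Bᴴ))).det = 0 := by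
      by_contra hd
      have := Matrix.rank_of_isUnit _
        ((Matrix.isUnit_iff_isUnit_det _).mpr (isUnit_iff_ne_zero.mpr hd))
      rw [Fintype.card_fin] at this
      exact absurd this hlt.ne
    obtain ⟨v, hv, hv0⟩ := Matrix.exists_mulVec_eq_zero_iff.mpr hdet
    rw [Matrix.sub_mulVec, Matrix.smul_mulVec, sub_eq_zero] at hv0
    exact hv (heig z (not_lt.mp hz) v hv0.symm)

/-- If Bᴴ w = 0 and E w = B b, then wᴴ E w = (Bᴴ w)ᴴ b = 0, hence E w = 0. -/
theorem disjoint_range_mul_leftNullBasis (hE : E.PosSemidef) {T₁ : Matrix (Fin n) (Fin k₁) ℂ}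
    (hT₁ : IsLeftNullBasis B T₁) :
    Disjoint (LinearMap.range (E * T₁).mulVecLin) (LinearMap.range B.mulVecLin) := by
  rw [Submodule.disjoint_def]
  rintro _ ⟨a, rfl⟩ ⟨b, hb⟩
  rw [Matrix.mulVecLin_apply, Matrix.mulVecLin_apply, ← Matrix.mulVec_mulVec] at hb
  rw [Matrix.mulVecLin_apply, ← Matrix.mulVec_mulVec, ← hE.dotProduct_mulVec_zero_iff, ← hb,
    star_dotProduct_mulVec_eq, (hT₁.exists_mulVec_iff _).mp ⟨a, rfl⟩]
  simp

/-- Every subspace of the range of `B` is added to the range of `E (ker Bᴴ)` by some feedback with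
`E + B K Bᴴ ≥ 0`. -/
theorem exists_feedback_range_eq (hE : E.PosSemidef) {T₁ : Matrix (Fin n) (Fin k₁) ℂ}
    (hT₁ : IsLeftNullBasis B T₁) {D : Submodule ℂ (Fin n → ℂ)}
    (hD : D ≤ LinearMap.range B.mulVecLin) :
    ∃ K : Matrix (Fin m) (Fin m) ℂ, (E + B * K * Bᴴ).PosSemidef ∧
      LinearMap.range (E + B * K * Bᴴ).mulVecLin = LinearMap.range (E * T₁).mulVecLin ⊔ D := by
  obtain ⟨Q, hQ⟩ := exists_range_mulVecLin_eq (D.comap B.mulVecLin)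
  have hBQ : LinearMap.range (B * Q).mulVecLin = D := by
    rw [Matrix.mulVecLin_mul, LinearMap.range_comp, hQ, Submodule.map_comap_eq,
      inf_eq_right.mpr hD]
  have hEH := hE.isHermitian.eq
  have hS : (T₁ᴴ * E * T₁).PosSemidef := hE.conjTranspose_mul_mul_same T₁
  obtain ⟨G, hG, hSG⟩ := exists_posSemidef_generalizedInverse hS
  -- A generalized Schur complement construction: E₀ is semidefinite with range in E(ker Bᴴ) and
  -- agrees with E on ker Bᴴ, so E - E₀ = B X Bᴴ can be removed by feedback.
  set E₀ := (E * T₁) * G * (E * T₁)ᴴ with hE₀def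
  have hE₀ : E₀.PosSemidef := hG.mul_mul_conjTranspose_same _
  have hE₀T : ∀ a, E₀ *ᵥ (T₁ *ᵥ a) = E *ᵥ (T₁ *ᵥ a) := by
    intro a
    have h1 : E₀ * T₁ = E * (T₁ * (G * (T₁ᴴ * E * T₁))) := by
      rw [hE₀def, Matrix.conjTranspose_mul, hEH]
      simp only [Matrix.mul_assoc]
    set v := G *ᵥ ((T₁ᴴ * E * T₁) *ᵥ a) - a with hv
    have h2 : (T₁ᴴ * E * T₁) *ᵥ v = 0 := by
      rw [hv, Matrix.mulVec_sub, Matrix.mulVec_mulVec, Matrix.mulVec_mulVec, hSG, sub_self]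
    have h3 : E *ᵥ (T₁ *ᵥ v) = 0 := by
      rw [← hE.dotProduct_mulVec_zero_iff, Matrix.star_mulVec, ← Matrix.dotProduct_mulVec,
        Matrix.mulVec_mulVec, Matrix.mulVec_mulVec, h2]
      simp
    rw [Matrix.mulVec_mulVec, h1, ← sub_eq_zero, ← h3, hv, Matrix.mulVec_sub, Matrix.mulVec_sub]
    simp only [← Matrix.mulVec_mulVec]
  obtain ⟨X, hX⟩ := exists_eq_mul_mul_conjTranspose (hE.isHermitian.sub hE₀.isHermitian) B
    (by
      intro w hw
      obtain ⟨a, rfl⟩ := (hT₁.exists_mulVec_iff w).mpr hw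
      rw [Matrix.sub_mulVec, hE₀T, sub_self])
  have hEK : E + B * (Q * Qᴴ - X) * Bᴴ = E₀ + (B * Q) * (B * Q)ᴴ := by
    rw [Matrix.mul_sub, Matrix.sub_mul, ← hX, Matrix.conjTranspose_mul]
    simp only [Matrix.mul_assoc]
    abel
  have hC := Matrix.posSemidef_self_mul_conjTranspose (B * Q)
  refine ⟨Q * Qᴴ - X, ?_, ?_⟩
  · rw [hEK]
    exact hE₀.add hC
  rw [hEK, ← hBQ]
  apply le_antisymm
  · rintro _ ⟨x, rfl⟩
    rw [Matrix.mulVecLin_apply, Matrix.add_mulVec]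
    refine Submodule.add_mem_sup ⟨(G * (E * T₁)ᴴ) *ᵥ x, ?_⟩ ⟨(B * Q)ᴴ *ᵥ x, ?_⟩
    · rw [Matrix.mulVecLin_apply, Matrix.mulVec_mulVec, ← Matrix.mul_assoc]
    · rw [Matrix.mulVecLin_apply, Matrix.mulVec_mulVec]
  -- The kernel of a sum of semidefinite matrices is the intersection of their kernels; dually, its
  -- range contains both ranges.
  · have horth : ∀ x, (E₀ + (B * Q) * (B * Q)ᴴ)ᴴ *ᵥ x = 0 →
        E₀ *ᵥ x = 0 ∧ (B * Q)ᴴ *ᵥ x = 0 := by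
      intro x hx
      rw [(hE₀.add hC).isHermitian.eq] at hx
      obtain ⟨h1, h2⟩ := hE₀.add_mulVec_eq_zero hC hx
      exact ⟨h1, (Matrix.self_mul_conjTranspose_mulVec_eq_zero _ x).mp h2⟩
    refine sup_le ?_ ?_
    · rintro _ ⟨a, rfl⟩
      apply exists_mulVec_eq_of_orthogonal
      intro x hx
      rw [Matrix.mulVecLin_apply, ← Matrix.mulVec_mulVec, ← hE₀T, star_dotProduct_mulVec_eq,
        hE₀.isHermitian.eq, (horth x hx).1]
      simp
    · rintro _ ⟨b, rfl⟩
      apply exists_mulVec_eq_of_orthogonal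
      intro x hx
      rw [Matrix.mulVecLin_apply, star_dotProduct_mulVec_eq, (horth x hx).2]
      simp

/-- If `x ∈ ker E ∩ ker Bᴴ` and `(J - R) x ∈ E (ker Bᴴ)`, the dual index condition forces `x = 0`. -/
theorem eq_zero_of_dual_index_condition (hE : E.PosSemidef) (hJ : J = -Jᴴ) (hR : R.PosSemidef)
    (hdual : ∀ x w, E *ᵥ x = 0 → Bᴴ *ᵥ x = 0 → Bᴴ *ᵥ w = 0 → (J - R)ᴴ *ᵥ x = E *ᵥ w → x = 0)
    {x w : Fin n → ℂ} (hEx : E *ᵥ x = 0) (hBx : Bᴴ *ᵥ x = 0) (hBw : Bᴴ *ᵥ w = 0)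
    (hxw : (J - R) *ᵥ x = E *ᵥ w) : x = 0 := by
  have hRx : R *ᵥ x = 0 := by
    apply mulVec_eq_zero_of_dissipative hJ hR
    rw [hxw, star_dotProduct_mulVec_eq, hE.isHermitian.eq, hEx]
    simp
  refine hdual x (-w) hEx hBx (by rw [Matrix.mulVec_neg, hBw, neg_zero]) ?_
  rw [conjTranspose_mulVec_of_mulVec_eq_zero hJ hR hRx, hxw, Matrix.mulVec_neg]

/-- This reduces the design to the choice of D: avoiding (J - R) N secures the index, and dim D sets
the rank because E(ker Bᴴ) ∩ im B = 0. -/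
theorem exists_stabilizingFeedback_of_submodule (hE : E.PosSemidef) (hJ : J = -Jᴴ)
    (hR : R.PosSemidef)
    (hdual : ∀ x w, E *ᵥ x = 0 → Bᴴ *ᵥ x = 0 → Bᴴ *ᵥ w = 0 → (J - R)ᴴ *ᵥ x = E *ᵥ w → x = 0)
    (h3 : ∀ s : ℂ, s.re = 0 → (Matrix.fromCols (J - R - s • E) B).rank = n)
    {T₁ : Matrix (Fin n) (Fin k₁) ℂ} (hT₁ : IsLeftNullBasis B T₁)
    {S₄ : Matrix (Fin n) (Fin k₄) ℂ} (hS₄ : IsRightNullBasis (Matrix.fromRows E Bᴴ) S₄)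
    {D : Submodule ℂ (Fin n → ℂ)} (hD : D ≤ LinearMap.range B.mulVecLin)
    (hdisj : Disjoint (LinearMap.range (E * T₁).mulVecLin ⊔ D)
      (LinearMap.range ((J - R) * S₄).mulVecLin)) :
    ∃ K F_S F_H : Matrix (Fin m) (Fin m) ℂ, IsStabilizingFeedback E J R B K F_S F_H ∧
      (E + B * K * Bᴴ).rank = (E * T₁).rank + finrank ℂ D := by
  obtain ⟨K, hK, hrange⟩ := exists_feedback_range_eq hE hT₁ hD
  refine ⟨K, 0, 1, isStabilizingFeedback_of_range hE hJ hR hK h3 ?_, ?_⟩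
  · intro x y hEx hBx hy
    have h1 : (J - R) *ᵥ x = 0 := by
      refine Submodule.disjoint_def.mp hdisj _ (hrange ▸ ⟨y, hy⟩) ?_
      obtain ⟨a, rfl⟩ := (hS₄.fromRows_iff x).mpr ⟨hEx, hBx⟩
      exact ⟨a, by rw [Matrix.mulVecLin_apply, Matrix.mulVec_mulVec]⟩
    refine eq_zero_of_dual_index_condition (w := 0) hE hJ hR hdual hEx hBx ?_ ?_ <;> simp [h1]
  · have h1 := Submodule.finrank_sup_add_finrank_inf_eq (LinearMap.range (E * T₁).mulVecLin) D
    rw [((disjoint_range_mul_leftNullBasis hE hT₁).mono_right hD).eq_bot, finrank_bot] at h1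
    rw [Matrix.rank, hrange, Matrix.rank]
    exact h1

/-- Subspaces of the range of `B` that can be added to `E (ker Bᴴ)` without meeting
`(J - R) (ker E ∩ ker Bᴴ)` exist in all dimensions up to the bound. -/
theorem exists_submodule_of_le (hE : E.PosSemidef)
    {T₁ : Matrix (Fin n) (Fin k₁) ℂ} (hT₁ : IsLeftNullBasis B T₁)
    {M : Matrix (Fin n) (Fin k₄) ℂ} {T₅ : Matrix (Fin n) (Fin k₅) ℂ} (hT₅ : IsLeftNullBasis M T₅)
    (hdisj : Disjoint (LinearMap.range (E * T₁).mulVecLin) (LinearMap.range M.mulVecLin))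
    {d : ℕ} (hd : (E * T₁).rank + d ≤ (T₅ᴴ * Matrix.fromCols E B).rank) :
    ∃ D ≤ LinearMap.range B.mulVecLin, finrank ℂ D = d ∧
      Disjoint (LinearMap.range (E * T₁).mulVecLin ⊔ D) (LinearMap.range M.mulVecLin) := by
  set P := LinearMap.range (E * T₁).mulVecLin with hP
  set U := LinearMap.range B.mulVecLin with hU
  set V := LinearMap.range (Matrix.fromCols E B).mulVecLin with hV
  set G := V ⊓ LinearMap.range M.mulVecLin with hG
  have hker : LinearMap.ker T₅ᴴ.mulVecLin = LinearMap.range M.mulVecLin := by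
    ext x
    exact hT₅.conjTranspose_mulVec_eq_zero_iff x
  have h1 := rank_mul_add_finrank_inf T₅ᴴ (Matrix.fromCols E B)
  rw [hker, ← rank_mul_leftNullBasis_add_rank hE.isHermitian hT₁] at h1
  change _ + finrank ℂ G = _ at h1
  have h2 := Submodule.finrank_sup_add_finrank_inf_eq P G
  have hPG : P ⊓ G = ⊥ := (hdisj.mono_right inf_le_right).eq_bot
  have h3 := Submodule.finrank_sup_add_finrank_inf_eq (P ⊔ G) U
  have h4 := Submodule.finrank_sup_add_finrank_inf_eq P U
  have h5 : finrank ℂ ↥(P ⊔ U) ≤ finrank ℂ ↥(P ⊔ G ⊔ U) :=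
    Submodule.finrank_mono (sup_le_sup_right le_sup_left U)
  rw [(disjoint_range_mul_leftNullBasis hE hT₁).eq_bot, finrank_bot] at h4
  rw [hPG, finrank_bot] at h2
  have hrP : (E * T₁).rank = finrank ℂ P := rfl
  have hrU : B.rank = finrank ℂ U := rfl
  -- The codimension of (P ⊔ G) ⊓ U in U is dim(P + G + U) - dim(P + G), at least dim(P + U) - dim P
  -- - dim G, which is rank(T₅ᴴ[E, B]) - rank(E T₁) and so at least d.
  obtain ⟨D, hDU, hDG, hDd⟩ := exists_submodule_disjoint_finrank_eq
    (inf_le_right : (P ⊔ G) ⊓ U ≤ U) (d := d) (by omega)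
  refine ⟨D, hDU, hDd, ?_⟩
  rw [Submodule.disjoint_def]
  intro x hx hxM
  obtain ⟨p, hp, v, hv, rfl⟩ := Submodule.mem_sup.mp hx
  have hpV : p ∈ V := by
    obtain ⟨a, rfl⟩ := hp
    exact ⟨Sum.elim (T₁ *ᵥ a) 0, by simp [Matrix.fromCols_mulVec]⟩
  have hvV : v ∈ V := range_mulVecLin_le_fromCols_right E B (hDU hv)
  -- If p + v lies in the range of M, it lies in G, so v = -p + (p + v) belongs to (P ⊔ G) ⊓ U,
  -- which D avoids.
  have hv0 : v = 0 := by
    refine Submodule.disjoint_def.mp hDG v hv ⟨?_, hDU hv⟩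
    have : v = -p + (p + v) := by abel
    rw [this]
    exact Submodule.add_mem_sup (P.neg_mem hp) ⟨V.add_mem hpV hvV, hxM⟩
  rw [hv0, add_zero] at hxM ⊢
  exact Submodule.disjoint_def.mp hdisj p hp hxM

theorem disjoint_range_of_dual_index_condition (hE : E.PosSemidef) (hJ : J = -Jᴴ)
    (hR : R.PosSemidef)
    (hdual : ∀ x w, E *ᵥ x = 0 → Bᴴ *ᵥ x = 0 → Bᴴ *ᵥ w = 0 → (J - R)ᴴ *ᵥ x = E *ᵥ w → x = 0)
    {T₁ : Matrix (Fin n) (Fin k₁) ℂ} (hT₁ : IsLeftNullBasis B T₁)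
    {S₄ : Matrix (Fin n) (Fin k₄) ℂ} (hS₄ : IsRightNullBasis (Matrix.fromRows E Bᴴ) S₄) :
    Disjoint (LinearMap.range (E * T₁).mulVecLin)
      (LinearMap.range ((J - R) * S₄).mulVecLin) := by
  rw [Submodule.disjoint_def]
  rintro _ ⟨a, rfl⟩ ⟨y, hy⟩
  simp only [Matrix.mulVecLin_apply, ← Matrix.mulVec_mulVec] at hy ⊢
  obtain ⟨hEx, hBx⟩ := (hS₄.fromRows_iff _).mp ⟨y, rfl⟩
  rw [← hy, eq_zero_of_dual_index_condition hE hJ hR hdual hEx hBx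
    ((hT₁.exists_mulVec_iff _).mp ⟨a, rfl⟩) hy, Matrix.mulVec_zero]

end ClosedLoop

theorem mainTheorem4 {n m : ℕ} (E J R : Matrix (Fin n) (Fin n) ℂ) (B : Matrix (Fin n) (Fin m) ℂ)
    (hE : E.PosSemidef) (hJ : J = -Jᴴ) (hR : R.PosSemidef)
    {k₁ k₂ k₃ k₄ k₅ : ℕ}
    -- `T₁ = T_∞(B)`, `T₂ = T_∞([E B])`, `S₃ = S_∞(T₂ᴴ (J - R))`
    (T₁ : Matrix (Fin n) (Fin k₁) ℂ) (hT₁ : IsLeftNullBasis B T₁)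
    (T₂ : Matrix (Fin n) (Fin k₂) ℂ) (hT₂ : IsLeftNullBasis (Matrix.fromCols E B) T₂)
    (S₃ : Matrix (Fin n) (Fin k₃) ℂ) (hS₃ : IsRightNullBasis (T₂ᴴ * (J - R)) S₃)
    -- `S₄ = S_∞([E; Bᴴ])`, `T₅ = T_∞((J - R) S₄)`
    (S₄ : Matrix (Fin n) (Fin k₄) ℂ) (hS₄ : IsRightNullBasis (Matrix.fromRows E Bᴴ) S₄)
    (T₅ : Matrix (Fin n) (Fin k₅) ℂ) (hT₅ : IsLeftNullBasis ((J - R) * S₄) T₅) :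
    ((∃ K F_S F_H : Matrix (Fin m) (Fin m) ℂ, IsStabilizingFeedback E J R B K F_S F_H) ↔
      (Matrix.fromCols (Matrix.fromCols E (J - R)) B).rank = n ∧
      ((T₁ᴴ * E * S₃).rank : ℤ) = ((Matrix.fromCols E B).rank : ℤ) - (B.rank : ℤ) ∧
      ∀ s : ℂ, s.re = 0 → (Matrix.fromCols (J - R - s • E) B).rank = n) ∧
    ((Matrix.fromCols (Matrix.fromCols E (J - R)) B).rank = n ∧
      ((T₁ᴴ * E * S₃).rank : ℤ) = ((Matrix.fromCols E B).rank : ℤ) - (B.rank : ℤ) ∧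
      (∀ s : ℂ, s.re = 0 → (Matrix.fromCols (J - R - s • E) B).rank = n) →
      ∀ r : ℤ,
        (∃ K F_S F_H : Matrix (Fin m) (Fin m) ℂ, IsStabilizingFeedback E J R B K F_S F_H ∧
          ((E + B * K * Bᴴ).rank : ℤ) = r) ↔
        ((Matrix.fromCols E B).rank : ℤ) - (B.rank : ℤ) ≤ r ∧
          r ≤ ((T₅ᴴ * Matrix.fromCols E B).rank : ℤ)) := by
  have hdualIff := rank_conditions_iff (J := J) (R := R) hE.isHermitian hT₁ hT₂ hS₃
  have hL := rank_mul_leftNullBasis_add_rank hE.isHermitian hT₁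
  refine ⟨⟨?_, ?_⟩, ?_⟩
  · rintro ⟨K, F_S, F_H, h⟩
    obtain ⟨h1, h2⟩ := hdualIff.mpr fun x w => h.dual_index_condition hJ
    exact ⟨h1, h2, fun s hs => h.rank_pencil_eq hs⟩
  · rintro ⟨h1, h2, h3⟩
    have hdual := hdualIff.mp ⟨h1, h2⟩
    -- D = ⊥ gives the smallest attainable rank and needs no room in im B.
    obtain ⟨K, F_S, F_H, h, -⟩ := exists_stabilizingFeedback_of_submodule (D := ⊥) hE hJ hR hdual
      h3 hT₁ hS₄ bot_le
      (by rw [sup_bot_eq]; exact disjoint_range_of_dual_index_condition hE hJ hR hdual hT₁ hS₄)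
    exact ⟨K, F_S, F_H, h⟩
  · rintro ⟨h1, h2, h3⟩ r
    have hdual := hdualIff.mp ⟨h1, h2⟩
    constructor
    · rintro ⟨K, F_S, F_H, h, rfl⟩
      have hlow := le_rank_add_feedback hE.isHermitian hT₁ K
      have hup := h.rank_le hS₄ hT₅
      constructor <;> omega
    · rintro ⟨hlow, hup⟩
      -- The lower bound on r makes r - rank(E T₁) nonnegative, so `toNat` loses nothing.
      obtain ⟨D, hD, hd, hdisj⟩ := exists_submodule_of_le (d := (r - (E * T₁).rank).toNat) hE hT₁ hT₅
        (disjoint_range_of_dual_index_condition hE hJ hR hdual hT₁ hS₄) (by omega)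
      obtain ⟨K, F_S, F_H, h, hr⟩ := exists_stabilizingFeedback_of_submodule hE hJ hR hdual
        h3 hT₁ hS₄ hD hdisj
      exact ⟨K, F_S, F_H, h, by omega⟩
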